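/- Let $s\ge 1$, let $F\in\mathbb C[x_1,\ldots,x_s]$ be a nonzero polynomial, and let $X=\mathbf V(F)\subset\mathbb C^s$. Let $p\in X$, and let $\mathcal O_{X,p}$ be the localization of $\mathbb C[x_1,\ldots,x_s]/\langle F\rangle$ at the maximal ideal corresponding to $p$, with maximal ideal $\mathfrak m_p$. The point $p$ is called non-singular if $\mathcal O_{X,p}$ is a regular local ring. Then, for every integer $n\ge 1$, the point $p$ is non-singular if and only if $$\dim_{\mathbb C}\mathfrak m_p/\mathfrak m_p^{n+1}=\binom{n+s-1}{s-1}-1 .$$ -/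

import Mathlib

noncomputable section

namespace Hypersurface

open MvPolynomial

variable {s : ℕ} (F : MvPolynomial (Fin s) ℂ)

/-- The set of points `V(F) ⊆ ℂ^s`. -/
def points : Set (Fin s → ℂ) := {p | eval p F = 0}

/-- The coordinate ring `ℂ[x₁, …, x_s] / ⟨F⟩`. -/
abbrev CoordRing : Type := MvPolynomial (Fin s) ℂ ⧸ Ideal.span {F}

/-- Evaluation at a point `p ∈ V(F)`, as a map `ℂ[x₁, …, x_s] / ⟨F⟩ → ℂ`. -/
def evalAt (p : points F) : CoordRing F →ₐ[ℂ] ℂ :=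
  Ideal.Quotient.liftₐ (Ideal.span {F}) (aeval (p : Fin s → ℂ)) fun a ha => by
    obtain ⟨g, rfl⟩ := Ideal.mem_span_singleton'.mp ha
    have h : eval (p : Fin s → ℂ) F = 0 := p.2
    simp [aeval_eq_eval, h]

/-- The maximal ideal of `ℂ[x₁, …, x_s] / ⟨F⟩` corresponding to the point `p`:
the classes of the polynomials that vanish at `p`. -/
def idealAt (p : points F) : Ideal (CoordRing F) := RingHom.ker (evalAt F p)

instance idealAt_isPrime (p : points F) : (idealAt F p).IsPrime :=
  RingHom.ker_isPrime (evalAt F p)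

/-- The local ring `𝒪_{X,p}` of `X = V(F)` at `p`: the localization of `ℂ[x₁, …, x_s] / ⟨F⟩`
at the maximal ideal corresponding to `p`. -/
abbrev LocalRingAt (p : points F) : Type := Localization.AtPrime (idealAt F p)

/-- `p` is a non-singular point of `X = V(F)`: the local ring `𝒪_{X,p}` is regular. -/
def IsNonsingularAt (p : points F) : Prop := IsRegularLocalRing (LocalRingAt F p)

/-- For a local ring `R` with maximal ideal `𝔪`, the `R`-module `𝔪 / 𝔪^{n+1}`, i.e. the quotient
of the module `𝔪` by its submodule `𝔪^{n+1}`. -/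
abbrev HigherCotangent (R : Type) [CommRing R] [IsLocalRing R] (n : ℕ) : Type :=
  IsLocalRing.maximalIdeal R ⧸
    (IsLocalRing.maximalIdeal R ^ (n + 1)).submoduleOf (IsLocalRing.maximalIdeal R)

end Hypersurface

end

/-!
Let `M` be the ideal of `p` in the polynomial ring `A`. Passing to the localization does not change
the quotients by powers of the maximal ideal, so `dim 𝔪/𝔪^{n+1} = dim A/(M^{n+1} + (F)) - 1`
(`Hypersurface.one_add_finrank_higherCotangent`). Multiplication by `F` gives the exact sequence
`0 → A/(M^{n+1} : F) → A/M^{n+1} → A/(M^{n+1} + (F)) → 0`, and after translating `p` to the origin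
`dim A/M^{n+1} - dim A/M^n` is the number of monomials of degree `n`, namely `(n+s-1).choose n`.

* If `F ∉ M²`, then `(M^{n+1} : F) = M^n`, because orders of vanishing are additive, and
  `dim A/(M^{n+1} + (F))` is exactly `(n+s-1).choose n`
  (`Hypersurface.finrank_quotient_sup_of_notMem_sq`).
* If `F ∈ M²`, then `(M^{n+1} : F) ⊇ M^{n-1}`, and as `dim A/M^{n-1} < dim A/M^n` the dimension is
  strictly larger (`Hypersurface.lt_finrank_quotient_sup_of_mem_sq`).

So for every `n ≥ 1` the dimension formula says that `F ∉ M²`. Regularity says the same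
(`Hypersurface.isNonsingularAt_iff_notMem_sq`): the local ring has dimension `s - 1`, and its
embedding dimension is the case `n = 1` of the count above.
-/

noncomputable section

namespace Hypersurface

open MvPolynomial

/-! ### Dimension counts for ideal quotients of an algebra over a field -/

section Quotients

variable {k A : Type*} [Field k] [CommRing A] [Algebra k A]

/-- Additivity of dimension in the exact sequence `0 → A/(I : f) → A/I → A/(I + (f)) → 0`, where the
first map is multiplication by `f`; the colon ideal is given by its defining property. -/
theorem finrank_quotient_sup_span_add (I J : Ideal A) (f : A)
    (hJ : ∀ g, g ∈ J ↔ f * g ∈ I) [Module.Finite k (A ⧸ I)] :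
    Module.finrank k (A ⧸ (I ⊔ Ideal.span {f})) + Module.finrank k (A ⧸ J) =
      Module.finrank k (A ⧸ I) := by
  let μ : A →ₗ[A] A ⧸ I := (Submodule.mkQ I).comp (LinearMap.mulLeft A f)
  have hker : LinearMap.ker μ = J := by
    ext g
    rw [hJ, LinearMap.mem_ker]
    exact Submodule.Quotient.mk_eq_zero I
  let π : (A ⧸ I) →ₗ[A] A ⧸ (I ⊔ Ideal.span {f}) := Submodule.factor le_sup_left
  have hπ : Function.Surjective π := Submodule.factor_surjective _
  have hrange : LinearMap.ker π = LinearMap.range μ := by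
    ext x
    obtain ⟨a, rfl⟩ := Submodule.Quotient.mk_surjective I x
    simp only [π, LinearMap.mem_ker, LinearMap.mem_range]
    rw [show Submodule.factor (le_sup_left : I ≤ I ⊔ Ideal.span {f}) (Submodule.Quotient.mk a) =
      Submodule.Quotient.mk a from rfl, Submodule.Quotient.mk_eq_zero, Submodule.mem_sup]
    constructor
    · rintro ⟨y, hy, z, hz, rfl⟩
      obtain ⟨c, rfl⟩ := Ideal.mem_span_singleton'.mp hz
      refine ⟨c, (Submodule.Quotient.eq I).mpr ?_⟩
      have : f * c - (y + c * f) = -y := by ring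
      simpa [this] using hy
    · rintro ⟨c, hc⟩
      have hc' : f * c - a ∈ I := (Submodule.Quotient.eq I).mp hc
      exact ⟨a - f * c, by simpa using I.neg_mem hc', f * c,
        Ideal.mul_mem_right _ _ (Ideal.mem_span_singleton_self f), by ring⟩
  have e : (A ⧸ J) ≃ₗ[A] LinearMap.ker π :=
    (Submodule.quotEquivOfEq _ _ hker.symm).trans
      (μ.quotKerEquivRange.trans (LinearEquiv.ofEq _ _ hrange.symm))
  have h := (π.restrictScalars k).finrank_range_add_finrank_ker
  rw [LinearMap.range_eq_top.mpr (by exact hπ), finrank_top] at h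
  rw [← h, (e.restrictScalars k).finrank_eq]
  rfl

/-- A larger ideal has the smaller quotient. -/
theorem finrank_quotient_le_of_le {I J : Ideal A} (h : I ≤ J) [Module.Finite k (A ⧸ I)] :
    Module.finrank k (A ⧸ J) ≤ Module.finrank k (A ⧸ I) :=
  LinearMap.finrank_le_finrank_of_surjective
    (f := ((Submodule.factor h : (A ⧸ I) →ₗ[A] A ⧸ J).restrictScalars k))
    (Submodule.factor_surjective h)

theorem finite_quotient_of_le {I J : Ideal A} (h : I ≤ J) [Module.Finite k (A ⧸ I)] :
    Module.Finite k (A ⧸ J) :=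
  Module.Finite.of_surjective ((Submodule.factor h : (A ⧸ I) →ₗ[A] A ⧸ J).restrictScalars k)
    (Submodule.factor_surjective h)

end Quotients

/-! ### Powers of the ideal of a point in affine space -/

section AffineSpace

variable {σ k : Type*} [Field k]

theorem finite_setOf_degree_lt (σ : Type*) [Finite σ] (n : ℕ) :
    {d : σ →₀ ℕ | d.degree < n}.Finite :=
  (Finsupp.finite_of_degree_le n).subset fun _ hd => le_of_lt (Set.mem_ofPred.mp hd)

/-- A polynomial modulo `(X)^n` is determined by its coefficients in degrees below `n`, and these
are arbitrary. -/
def quotientPowIdealOfVarsEquiv (σ k : Type*) [Field k] [Finite σ] (n : ℕ) :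
    (MvPolynomial σ k ⧸ idealOfVars σ k ^ n) ≃ₗ[k] ({d : σ →₀ ℕ | d.degree < n} → k) :=
  letI φ : MvPolynomial σ k →ₗ[k] ({d : σ →₀ ℕ | d.degree < n} → k) :=
    LinearMap.pi fun d => MvPolynomial.lcoeff k d.1
  haveI hker : (idealOfVars σ k ^ n).restrictScalars k = LinearMap.ker φ := by
    ext g
    rw [Submodule.restrictScalars_mem, mem_pow_idealOfVars_iff', LinearMap.mem_ker, funext_iff]
    simp [φ]
  haveI hsurj : Function.Surjective φ := by
    classical
    intro v
    have := (finite_setOf_degree_lt σ n).fintype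
    refine ⟨∑ d, monomial d.1 (v d), ?_⟩
    ext d
    simp only [φ, LinearMap.pi_apply, lcoeff_apply, coeff_sum, coeff_monomial, Subtype.coe_inj]
    simp
  ((Submodule.Quotient.restrictScalarsEquiv k (idealOfVars σ k ^ n)).symm.trans
    (Submodule.quotEquivOfEq _ _ hker)).trans (φ.quotKerEquivOfSurjective hsurj)

variable [Fintype σ]

theorem finite_quotient_pow_idealOfVars (n : ℕ) :
    Module.Finite k (MvPolynomial σ k ⧸ idealOfVars σ k ^ n) :=
  have : Finite {d : σ →₀ ℕ | d.degree < n} := finite_setOf_degree_lt σ n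
  Module.Finite.equiv (quotientPowIdealOfVarsEquiv σ k n).symm

theorem finrank_quotient_pow_idealOfVars (n : ℕ) :
    Module.finrank k (MvPolynomial σ k ⧸ idealOfVars σ k ^ n) =
      {d : σ →₀ ℕ | d.degree < n}.ncard := by
  have := (finite_setOf_degree_lt σ n).fintype
  rw [(quotientPowIdealOfVarsEquiv σ k n).finrank_eq, Module.finrank_fintype_fun_eq_card,
    ← Nat.card_eq_fintype_card, Nat.card_coe_set_eq]

/-- The monomials of degree `n` are the difference between two consecutive quotients. -/
theorem finrank_quotient_pow_succ_idealOfVars (n : ℕ) :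
    Module.finrank k (MvPolynomial σ k ⧸ idealOfVars σ k ^ (n + 1)) =
      Module.finrank k (MvPolynomial σ k ⧸ idealOfVars σ k ^ n) +
        (Fintype.card σ + n - 1).choose n := by
  classical
  have hunion : {d : σ →₀ ℕ | d.degree < n + 1} =
      {d : σ →₀ ℕ | d.degree < n} ∪ (Finset.univ.finsuppAntidiag n : Finset (σ →₀ ℕ)) := by
    ext d
    simp [Finset.mem_finsuppAntidiag, ← Finsupp.degree_eq_sum]
    omega
  rw [finrank_quotient_pow_idealOfVars, finrank_quotient_pow_idealOfVars, hunion,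
    Set.ncard_union_eq _ (finite_setOf_degree_lt σ n) (Finset.finite_toSet _),
    Set.ncard_coe_finset, Finset.card_finsuppAntidiag_nat_eq_choose, Finset.card_univ]
  rw [Set.disjoint_left]
  intro d hd hd'
  simp [Finset.mem_finsuppAntidiag, ← Finsupp.degree_eq_sum] at hd hd'
  omega

omit [Fintype σ] in
theorem mem_pow_idealOfVars_iff_le_order (n : ℕ) (g : MvPolynomial σ k) :
    g ∈ idealOfVars σ k ^ n ↔ (n : ℕ∞) ≤ (g : MvPowerSeries σ k).order := by
  rw [mem_pow_idealOfVars_iff']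
  refine ⟨fun h => MvPowerSeries.nat_le_order fun d hd => by simpa using h d hd, fun h d hd => ?_⟩
  rw [← coeff_coe]
  exact MvPowerSeries.coeff_of_lt_order (lt_of_lt_of_le (by exact_mod_cast hd) h)

omit [Fintype σ] in
/-- Orders of vanishing add up, so a factor of order at most one can be cancelled. -/
theorem mem_pow_idealOfVars_of_mul_mem {f g : MvPolynomial σ k} {n : ℕ}
    (hf : f ∉ idealOfVars σ k ^ 2) (hfg : f * g ∈ idealOfVars σ k ^ (n + 1)) :
    g ∈ idealOfVars σ k ^ n := by
  rw [mem_pow_idealOfVars_iff_le_order] at hf hfg ⊢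
  rw [coe_mul, MvPowerSeries.order_mul] at hfg
  generalize (f : MvPowerSeries σ k).order = a at *
  generalize (g : MvPowerSeries σ k).order = b at *
  cases b with
  | top => simp
  | coe b =>
    cases a with
    | top => simp at hf
    | coe a =>
      norm_cast at *
      omega

/-- The ideal of the polynomials vanishing at `p`. -/
def pointIdeal (p : σ → k) : Ideal (MvPolynomial σ k) := RingHom.ker (aeval (R := k) p)

omit [Fintype σ] in
@[simp]
theorem mem_pointIdeal {p : σ → k} {g : MvPolynomial σ k} :
    g ∈ pointIdeal p ↔ aeval p g = 0 := Iff.rfl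

/-- The translation of affine space taking the origin to `p`. -/
def translateEquiv (p : σ → k) : MvPolynomial σ k ≃ₐ[k] MvPolynomial σ k :=
  AlgEquiv.ofAlgHom (aeval fun i => X i + C (p i)) (aeval fun i => X i - C (p i))
    (by ext i; simp [algHom_C, algebraMap_eq]) (by ext i; simp [algHom_C, algebraMap_eq])

omit [Fintype σ] in
theorem map_translateEquiv_pointIdeal (p : σ → k) :
    (pointIdeal p).map (translateEquiv p) = idealOfVars σ k := by
  have h : pointIdeal p = (idealOfVars σ k).comap (translateEquiv p) := by
    ext g
    rw [Ideal.mem_comap, ← pow_one (idealOfVars σ k), mem_pow_idealOfVars_iff', mem_pointIdeal]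
    have h0 : aeval p g = constantCoeff (translateEquiv p g) := by
      suffices (aeval p : MvPolynomial σ k →ₐ[k] k).toRingHom =
          constantCoeff.comp (translateEquiv p : MvPolynomial σ k →+* MvPolynomial σ k) from
        congr($this g)
      ext i <;> simp [translateEquiv]
    rw [h0, constantCoeff_eq]
    simp [Finsupp.degree_eq_zero_iff]
  rw [h]
  exact Ideal.map_comap_of_surjective _ (translateEquiv p).surjective _

omit [Fintype σ] in
theorem map_translateEquiv_pow_pointIdeal (p : σ → k) (n : ℕ) :
    (pointIdeal p ^ n).map (translateEquiv p) = idealOfVars σ k ^ n := by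
  rw [Ideal.map_pow, map_translateEquiv_pointIdeal]

omit [Fintype σ] in
theorem mem_pow_pointIdeal_iff (p : σ → k) (n : ℕ) (g : MvPolynomial σ k) :
    g ∈ pointIdeal p ^ n ↔ translateEquiv p g ∈ idealOfVars σ k ^ n := by
  rw [← map_translateEquiv_pow_pointIdeal p, Ideal.mem_map_of_equiv]
  simp

/-- Translation identifies the quotients by the powers of the ideals of `p` and of the origin. -/
def quotientPowPointIdealEquiv (p : σ → k) (n : ℕ) :
    (MvPolynomial σ k ⧸ pointIdeal p ^ n) ≃ₐ[k] MvPolynomial σ k ⧸ idealOfVars σ k ^ n :=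
  Ideal.quotientEquivAlg _ _ (translateEquiv p) (map_translateEquiv_pow_pointIdeal p n).symm

instance finite_quotient_pow_pointIdeal (p : σ → k) (n : ℕ) :
    Module.Finite k (MvPolynomial σ k ⧸ pointIdeal p ^ n) :=
  have := finite_quotient_pow_idealOfVars (σ := σ) (k := k) n
  Module.Finite.equiv (quotientPowPointIdealEquiv p n).symm.toLinearEquiv

theorem finrank_quotient_pow_succ_pointIdeal (p : σ → k) (n : ℕ) :
    Module.finrank k (MvPolynomial σ k ⧸ pointIdeal p ^ (n + 1)) =
      Module.finrank k (MvPolynomial σ k ⧸ pointIdeal p ^ n) +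
        (Fintype.card σ + n - 1).choose n := by
  rw [(quotientPowPointIdealEquiv p _).toLinearEquiv.finrank_eq,
    (quotientPowPointIdealEquiv p _).toLinearEquiv.finrank_eq,
    finrank_quotient_pow_succ_idealOfVars]

omit [Fintype σ] in
theorem mem_pow_pointIdeal_of_mul_mem {p : σ → k} {f g : MvPolynomial σ k} {n : ℕ}
    (hf : f ∉ pointIdeal p ^ 2) (hfg : f * g ∈ pointIdeal p ^ (n + 1)) :
    g ∈ pointIdeal p ^ n := by
  rw [mem_pow_pointIdeal_iff] at *
  exact mem_pow_idealOfVars_of_mul_mem hf (by simpa using hfg)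

/-- At a point where `f` vanishes to first order, the colon ideal `(M^{n+1} : f)` is `M^n`. -/
theorem finrank_quotient_sup_of_notMem_sq {p : σ → k} {f : MvPolynomial σ k}
    (hfp : f ∈ pointIdeal p) (hf : f ∉ pointIdeal p ^ 2) (n : ℕ) :
    Module.finrank k (MvPolynomial σ k ⧸ (pointIdeal p ^ (n + 1) ⊔ Ideal.span {f})) =
      (Fintype.card σ + n - 1).choose n := by
  have h := finrank_quotient_sup_span_add (k := k) (pointIdeal p ^ (n + 1)) (pointIdeal p ^ n) f
    fun g => ⟨fun hg => by rw [pow_succ']; exact Ideal.mul_mem_mul hfp hg,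
      mem_pow_pointIdeal_of_mul_mem hf⟩
  rw [finrank_quotient_pow_succ_pointIdeal] at h
  omega

/-- At a point where `f` vanishes to order at least two, the colon ideal `(M^{n+1} : f)` contains
`M^{n-1}`, so its quotient is too small. -/
theorem lt_finrank_quotient_sup_of_mem_sq [Nonempty σ] {p : σ → k} {f : MvPolynomial σ k}
    (hf : f ∈ pointIdeal p ^ 2) {n : ℕ} (hn : 1 ≤ n) :
    (Fintype.card σ + n - 1).choose n <
      Module.finrank k (MvPolynomial σ k ⧸ (pointIdeal p ^ (n + 1) ⊔ Ideal.span {f})) := by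
  obtain ⟨m, rfl⟩ := Nat.exists_eq_add_of_le' hn
  have h := finrank_quotient_sup_span_add (k := k) (pointIdeal p ^ (m + 1 + 1))
    (Submodule.colon (pointIdeal p ^ (m + 1 + 1)) {f}) f
    fun g => by rw [Submodule.mem_colon_singleton, smul_eq_mul, mul_comm]
  have hle : pointIdeal p ^ m ≤ Submodule.colon (pointIdeal p ^ (m + 1 + 1)) {f} := fun g hg => by
    rw [Submodule.mem_colon_singleton, smul_eq_mul, add_assoc, pow_add]
    exact Ideal.mul_mem_mul hg hf
  have h1 := finrank_quotient_le_of_le (k := k) hle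
  rw [finrank_quotient_pow_succ_pointIdeal p (m + 1), finrank_quotient_pow_succ_pointIdeal p m] at h
  have h2 : 0 < (Fintype.card σ + m - 1).choose m :=
    Nat.choose_pos (by have := Fintype.card_pos (α := σ); omega)
  omega

end AffineSpace

end Hypersurface
end

noncomputable section

namespace Hypersurface

open IsLocalRing

/-! ### Local rings of algebras at rational points -/

section LocalRings

variable {k R : Type} [Field k] [CommRing R] [Algebra k R] [IsLocalRing R]

/-- Additivity of dimension in `0 → 𝔪/𝔪^{n+1} → R/𝔪^{n+1} → R/𝔪 → 0`. -/
theorem finrank_residueField_add_finrank_higherCotangent (n : ℕ)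
    [Module.Finite k (R ⧸ maximalIdeal R ^ (n + 1))] :
    Module.Finite k (HigherCotangent R n) ∧
      Module.finrank k (ResidueField R) + Module.finrank k (HigherCotangent R n) =
        Module.finrank k (R ⧸ maximalIdeal R ^ (n + 1)) := by
  set m := maximalIdeal R
  have hle : m ^ (n + 1) ≤ m := Ideal.pow_le_self n.succ_ne_zero
  let π : (R ⧸ m ^ (n + 1)) →ₗ[R] R ⧸ m := Submodule.factor hle
  let ι : m →ₗ[R] R ⧸ m ^ (n + 1) := (Submodule.mkQ (m ^ (n + 1))).comp m.subtype
  have hker : LinearMap.ker ι = (m ^ (n + 1)).submoduleOf m := by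
    ext x
    rw [LinearMap.mem_ker, Submodule.submoduleOf, Submodule.mem_comap]
    exact Submodule.Quotient.mk_eq_zero _
  have hrange : LinearMap.range ι = LinearMap.ker π := by
    ext x
    obtain ⟨a, rfl⟩ := Submodule.Quotient.mk_surjective _ x
    rw [LinearMap.mem_ker,
      show π (Submodule.Quotient.mk a) = Submodule.Quotient.mk a from rfl,
      Submodule.Quotient.mk_eq_zero]
    constructor
    · rintro ⟨y, hy⟩
      have hy' : (y : R) - a ∈ m ^ (n + 1) := (Submodule.Quotient.eq _).mp hy
      simpa using m.sub_mem y.2 (hle hy')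
    · exact fun ha => ⟨⟨a, ha⟩, rfl⟩
  have e : HigherCotangent R n ≃ₗ[R] LinearMap.ker π :=
    (Submodule.quotEquivOfEq _ _ hker.symm).trans
      (ι.quotKerEquivRange.trans (LinearEquiv.ofEq _ _ hrange))
  have : Module.Finite k (LinearMap.ker π) :=
    inferInstanceAs (Module.Finite k (LinearMap.ker (π.restrictScalars k)))
  refine ⟨Module.Finite.equiv (e.restrictScalars k).symm, ?_⟩
  have h := (π.restrictScalars k).finrank_range_add_finrank_ker
  rw [LinearMap.range_eq_top.mpr (by exact Submodule.factor_surjective hle), finrank_top] at h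
  rw [← h, (e.restrictScalars k).finrank_eq]
  rfl

/-- For `n = 1` the module `𝔪/𝔪^{n+1}` is the cotangent space. -/
def higherCotangentOneEquiv (R : Type) [CommRing R] [IsLocalRing R] :
    HigherCotangent R 1 ≃ₗ[R] CotangentSpace R :=
  Submodule.quotEquivOfEq _ _ <| by
    ext x
    rw [Submodule.submoduleOf, Submodule.mem_comap, Submodule.mem_smul_top_iff]
    simp [pow_two]

/-- At a rational point, dimension over the residue field is dimension over the base field. -/
theorem finrank_cotangentSpace_eq (h : Module.finrank k (ResidueField R) = 1) :
    Module.finrank (ResidueField R) (CotangentSpace R) =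
      Module.finrank k (HigherCotangent R 1) := by
  have : IsScalarTower k (ResidueField R) (CotangentSpace R) := by
    refine ⟨fun a x y => ?_⟩
    obtain ⟨r, rfl⟩ := residue_surjective x
    rw [← algebraMap_smul R a (residue R r), ← algebraMap_smul R a (residue R r • y), smul_assoc]
  rw [((higherCotangentOneEquiv R).restrictScalars k).finrank_eq,
    ← Module.finrank_mul_finrank k (ResidueField R) (CotangentSpace R), h, one_mul]

variable {B : Type} [CommRing B] [Algebra k B]

/-- The local ring of `B` at a rational point `I` has the same quotients `R/𝔪^n = B/I^n` as `B`
itself, hence `dim 𝔪/𝔪^{n+1} = dim B/I^{n+1} - 1`. -/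
theorem finrank_higherCotangent_localization (I : Ideal B) [I.IsMaximal]
    (hI : Module.finrank k (B ⧸ I) = 1) (n : ℕ) [Module.Finite k (B ⧸ I ^ (n + 1))] :
    Module.Finite k (HigherCotangent (Localization.AtPrime I) n) ∧
      1 + Module.finrank k (HigherCotangent (Localization.AtPrime I) n) =
        Module.finrank k (B ⧸ I ^ (n + 1)) ∧
      Module.finrank k (ResidueField (Localization.AtPrime I)) = 1 := by
  have e (j : ℕ) := (IsLocalization.AtPrime.equivQuotMaximalIdealPow I
    (Localization.AtPrime I) j).toLinearEquiv.restrictScalars k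
  have : Module.Finite k
      (Localization.AtPrime I ⧸ maximalIdeal (Localization.AtPrime I) ^ (n + 1)) :=
    Module.Finite.equiv (e (n + 1))
  have hres : Module.finrank k (ResidueField (Localization.AtPrime I)) = 1 := by
    have h1 := (e 1).finrank_eq
    rw [pow_one, pow_one, hI] at h1
    exact h1.symm
  obtain ⟨hfin, h⟩ := finrank_residueField_add_finrank_higherCotangent (k := k)
    (R := Localization.AtPrime I) n
  exact ⟨hfin, by rw [(e (n + 1)).finrank_eq, ← h, hres], hres⟩

/-- The embedding dimension of the local ring of `B` at a rational point `I` is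
`dim B/I² - 1`. -/
theorem spanFinrank_maximalIdeal_localization [IsNoetherianRing B] (I : Ideal B) [I.IsMaximal]
    (hI : Module.finrank k (B ⧸ I) = 1) [Module.Finite k (B ⧸ I ^ 2)] :
    1 + (maximalIdeal (Localization.AtPrime I)).spanFinrank = Module.finrank k (B ⧸ I ^ 2) := by
  have : IsNoetherianRing (Localization.AtPrime I) :=
    IsLocalization.isNoetherianRing I.primeCompl _ inferInstance
  obtain ⟨-, h, hres⟩ := finrank_higherCotangent_localization (k := k) I hI 1
  rw [spanFinrank_maximalIdeal_eq_finrank_cotangentSpace, finrank_cotangentSpace_eq hres, h]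

end LocalRings

end Hypersurface
end

noncomputable section

namespace Hypersurface

open MvPolynomial IsLocalRing

/-! ### The hypersurface -/

theorem ker_algHom_isMaximal {k B : Type*} [Field k] [CommRing B] [Algebra k B] (ε : B →ₐ[k] k) :
    (RingHom.ker ε).IsMaximal :=
  RingHom.ker_isMaximal_of_surjective ε fun c => ⟨algebraMap k B c, by simp⟩

theorem finrank_quotient_ker_algHom {k B : Type*} [Field k] [CommRing B] [Algebra k B]
    (ε : B →ₐ[k] k) : Module.finrank k (B ⧸ RingHom.ker ε) = 1 := by
  have h : Function.Surjective ε := fun c => ⟨algebraMap k B c, by simp⟩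
  rw [(Ideal.quotientKerAlgEquivOfSurjective h).toLinearEquiv.finrank_eq, Module.finrank_self]

instance pointIdeal_isMaximal {σ k : Type*} [Field k] (p : σ → k) : (pointIdeal p).IsMaximal := ker_algHom_isMaximal _

instance idealAt_isMaximal {s : ℕ} (F : MvPolynomial (Fin s) ℂ) (p : points F) : (idealAt F p).IsMaximal :=
  ker_algHom_isMaximal _

variable {s : ℕ} {F : MvPolynomial (Fin s) ℂ} (p : points F)

theorem equation_mem_pointIdeal : F ∈ pointIdeal (p : Fin s → ℂ) := by
  have h : eval (p : Fin s → ℂ) F = 0 := p.2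
  simpa [aeval_eq_eval] using h

theorem idealAt_eq_map :
    idealAt F p = (pointIdeal (p : Fin s → ℂ)).map (Ideal.Quotient.mk (Ideal.span {F})) := by
  ext x
  obtain ⟨g, rfl⟩ := Ideal.Quotient.mk_surjective x
  rw [Ideal.mem_quotient_iff_mem ((Ideal.span_singleton_le_iff_mem _).mpr
    (equation_mem_pointIdeal p))]
  rfl

/-- The quotient of the coordinate ring by a power of the ideal of `p`, as a quotient of the
polynomial ring. -/
def quotientPowIdealAtEquiv (n : ℕ) :
    (CoordRing F ⧸ idealAt F p ^ n) ≃ₐ[ℂ]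
      MvPolynomial (Fin s) ℂ ⧸ (pointIdeal (p : Fin s → ℂ) ^ n ⊔ Ideal.span {F}) :=
  ((Ideal.quotientEquivAlgOfEq ℂ (by rw [idealAt_eq_map, ← Ideal.map_pow]; rfl)).trans
    (DoubleQuot.quotQuotEquivQuotSupₐ ℂ (Ideal.span {F}) (pointIdeal (p : Fin s → ℂ) ^ n))).trans
    (Ideal.quotientEquivAlgOfEq ℂ (sup_comm _ _))

instance finite_quotient_pow_idealAt (n : ℕ) : Module.Finite ℂ (CoordRing F ⧸ idealAt F p ^ n) :=
  have := finite_quotient_of_le (k := ℂ)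
    (le_sup_left : _ ≤ pointIdeal (p : Fin s → ℂ) ^ n ⊔ Ideal.span {F})
  Module.Finite.equiv (quotientPowIdealAtEquiv p n).symm.toLinearEquiv

theorem finite_higherCotangent (n : ℕ) :
    Module.Finite ℂ (HigherCotangent (LocalRingAt F p) n) :=
  (finrank_higherCotangent_localization (k := ℂ) (idealAt F p)
    (finrank_quotient_ker_algHom _) n).1

theorem one_add_finrank_higherCotangent (n : ℕ) :
    1 + Module.finrank ℂ (HigherCotangent (LocalRingAt F p) n) =
      Module.finrank ℂ (MvPolynomial (Fin s) ℂ ⧸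
        (pointIdeal (p : Fin s → ℂ) ^ (n + 1) ⊔ Ideal.span {F})) := by
  rw [(finrank_higherCotangent_localization (k := ℂ) (idealAt F p)
    (finrank_quotient_ker_algHom _) n).2.1,
    (quotientPowIdealAtEquiv p (n + 1)).toLinearEquiv.finrank_eq]

theorem one_add_spanFinrank_maximalIdeal :
    1 + (maximalIdeal (LocalRingAt F p)).spanFinrank =
      Module.finrank ℂ (MvPolynomial (Fin s) ℂ ⧸
        (pointIdeal (p : Fin s → ℂ) ^ 2 ⊔ Ideal.span {F})) := by
  rw [spanFinrank_maximalIdeal_localization (k := ℂ) (idealAt F p)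
    (finrank_quotient_ker_algHom _), (quotientPowIdealAtEquiv p 2).toLinearEquiv.finrank_eq]

/-- Affine space is regular, so the height of the ideal of a point is `dim M/M² = s`. -/
theorem height_pointIdeal (q : Fin s → ℂ) : (pointIdeal q).height = s := by
  have hreg : IsRegularLocalRing (Localization.AtPrime (pointIdeal q)) := inferInstance
  have h := spanFinrank_maximalIdeal_localization (k := ℂ) (pointIdeal q)
    (finrank_quotient_ker_algHom _)
  have h2 : Module.finrank ℂ (MvPolynomial (Fin s) ℂ ⧸ pointIdeal q ^ 2) = 1 + s := by
    rw [finrank_quotient_pow_succ_pointIdeal, finrank_quotient_pow_succ_pointIdeal, pow_zero,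
      Ideal.one_eq_top, Module.finrank_zero_of_subsingleton]
    simp
  have hdim := hreg.spanFinrank_maximalIdeal
  rw [IsLocalization.AtPrime.ringKrullDim_eq_height (pointIdeal q)] at hdim
  rw [show (maximalIdeal (Localization.AtPrime (pointIdeal q))).spanFinrank = s by omega] at hdim
  exact_mod_cast hdim.symm

/-- Every point of a hypersurface in `s`-dimensional affine space has a local ring of dimension
`s - 1`: one equation lowers the height of the ideal of the point by at most one, and a
nonzerodivisor lowers the dimension of the whole ring by at least one. -/
theorem ringKrullDim_localRingAt_add_one (hF : F ≠ 0) :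
    ringKrullDim (LocalRingAt F p) + 1 = s := by
  rw [IsLocalization.AtPrime.ringKrullDim_eq_height (idealAt F p) (LocalRingAt F p)]
  apply le_antisymm
  · have h := ringKrullDim_quotient_succ_le_of_nonZeroDivisor (mem_nonZeroDivisors_of_ne_zero hF)
    rw [MvPolynomial.ringKrullDim_of_isNoetherianRing, ringKrullDim_eq_zero_of_field,
      zero_add, Nat.card_fin] at h
    refine le_trans ?_ h
    gcongr
    exact Ideal.height_le_ringKrullDim_of_ne_top Ideal.IsPrime.ne_top'
  · have h := Ideal.height_le_height_add_one_of_mem (equation_mem_pointIdeal p)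
    rw [height_pointIdeal, ← idealAt_eq_map] at h
    exact_mod_cast h

/-- In zero variables a nonzero polynomial is a nonzero constant and has no zeros. -/
theorem pos_of_point {s : ℕ} {F : MvPolynomial (Fin s) ℂ} (p : points F) (hF : F ≠ 0) : 0 < s := by
  rcases Nat.eq_zero_or_pos s with rfl | h
  · refine absurd ?_ hF
    have h := equation_mem_pointIdeal p
    rw [mem_pointIdeal] at h
    generalize (p : Fin 0 → ℂ) = q at h
    rw [F.eq_C_of_isEmpty] at h
    rw [F.eq_C_of_isEmpty]
    simpa [aeval_C] using h
  · exact h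

/-- The Jacobian criterion, without coordinates: regularity means that the equation does not
vanish to second order. -/
theorem isNonsingularAt_iff_notMem_sq (hF : F ≠ 0) :
    IsNonsingularAt F p ↔ F ∉ pointIdeal (p : Fin s → ℂ) ^ 2 := by
  have hs := pos_of_point p hF
  have : Nonempty (Fin s) := ⟨⟨0, hs⟩⟩
  have : IsNoetherianRing (LocalRingAt F p) :=
    IsLocalization.isNoetherianRing (idealAt F p).primeCompl _ inferInstance
  have hdim := ringKrullDim_localRingAt_add_one p hF
  have hspan := one_add_spanFinrank_maximalIdeal p
  -- The dimension is finite, so `1` can be cancelled in `WithBot ℕ∞`.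
  have hcancel (a : ℕ) : (a : WithBot ℕ∞) = ringKrullDim (LocalRingAt F p) ↔ a + 1 = s := by
    rw [IsLocalization.AtPrime.ringKrullDim_eq_height (idealAt F p) (LocalRingAt F p)] at hdim ⊢
    generalize (idealAt F p).height = b at *
    cases b with
    | top => exact absurd hdim (by norm_cast; exact ENat.top_ne_natCast _)
    | coe b =>
      norm_cast at hdim ⊢
      omega
  rw [IsNonsingularAt, isRegularLocalRing_iff, hcancel]
  constructor
  · intro h hmem
    have := lt_finrank_quotient_sup_of_mem_sq hmem le_rfl
    simp at this
    omega
  · intro h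
    have := finrank_quotient_sup_of_notMem_sq (equation_mem_pointIdeal p) h 1
    simp at this
    omega

end Hypersurface
end

theorem mainTheorem6 (s : ℕ) (F : MvPolynomial (Fin s) ℂ) (hF : F ≠ 0)
    (p : Hypersurface.points F) (n : ℕ) (hn : 1 ≤ n) :
    Hypersurface.IsNonsingularAt F p ↔
      Module.rank ℂ (Hypersurface.HigherCotangent (Hypersurface.LocalRingAt F p) n) =
        (((n + s - 1).choose (s - 1) - 1 : ℕ) : Cardinal) := by
  have hs := Hypersurface.pos_of_point p hF
  have : Nonempty (Fin s) := ⟨⟨0, hs⟩⟩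
  have := Hypersurface.finite_higherCotangent p n
  have hdim := Hypersurface.one_add_finrank_higherCotangent p n
  have hchoose : (Fintype.card (Fin s) + n - 1).choose n = (n + s - 1).choose (s - 1) := by
    rw [Fintype.card_fin, add_comm s n]
    exact Nat.choose_symm_of_eq_add (by omega)
  have hpos : 0 < (n + s - 1).choose (s - 1) := Nat.choose_pos (by omega)
  rw [← Module.finrank_eq_rank, Nat.cast_inj, Hypersurface.isNonsingularAt_iff_notMem_sq p hF]
  constructor
  · intro h
    rw [Hypersurface.finrank_quotient_sup_of_notMem_sq
      (Hypersurface.equation_mem_pointIdeal p) h n] at hdim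
    omega
  · intro h hmem
    have := Hypersurface.lt_finrank_quotient_sup_of_mem_sq hmem hn
    omega
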